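/- Let $\mathbb K\in\{\mathbb R,\mathbb C\}$. For a Banach space $X$ over $\mathbb K$ and a bounded sequence $(x^*_n)_{n\in\mathbb N}$ in the dual $X^*$, put $$\delta_w(x^*_n)=\sup_{x^{**}\in B_{X^{**}}}\ \inf_{n\in\mathbb N}\ \sup_{k,l\ge n}|x^{**}(x^*_k)-x^{**}(x^*_l)|,\qquad \delta_{w^*}(x^*_n)=\sup_{x\in B_X}\ \inf_{n\in\mathbb N}\ \sup_{k,l\ge n}|x^*_k(x)-x^*_l(x)|,$$ where $B_X$ and $B_{X^{**}}$ are the closed unit balls of $X$ and of its bidual. For $c\ge 1$, the space $X$ is called $c$-Grothendieck if $\delta_w(x^*_n)\le c\,\delta_{w^*}(x^*_n)$ for every bounded sequence $(x^*_n)$ in $X^*$. Let $\mu$ be a $\sigma$-finite measure on a measurable space, and let $L^\infty(\mu)$ be the Banach space of ($\mu$-a.e. equivalence classes of) essentially bounded measurable $\mathbb K$-valued functions with the essential supremum norm. Then $L^\infty(\mu)$ is $1$-Grothendieck. -/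

import Mathlib

open scoped ENNReal NNReal

/-- The oscillation at infinity `inf_n sup_{k, l ≥ n} |a_k - a_l|` of a scalar sequence, as an
extended nonnegative real (so that no supremum is junk-valued). -/
noncomputable def seqOsc {𝕜 : Type*} [RCLike 𝕜] (a : ℕ → 𝕜) : ℝ≥0∞ :=
  ⨅ n : ℕ, ⨆ (k : ℕ) (_ : n ≤ k) (l : ℕ) (_ : n ≤ l), ‖a k - a l‖ₑ

/-- The measure of weak non-Cauchyness of a sequence in `X*`: the supremum over the closed unit
ball of the bidual `X**` of the oscillation of `x**(x*_n)`. -/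
noncomputable def deltaWeak {𝕜 X : Type*} [RCLike 𝕜] [NormedAddCommGroup X] [NormedSpace 𝕜 X]
    (ξ : ℕ → StrongDual 𝕜 X) : ℝ≥0∞ :=
  ⨆ (F : StrongDual 𝕜 (StrongDual 𝕜 X)) (_ : ‖F‖ ≤ 1), seqOsc fun n => F (ξ n)

/-- The measure of weak-star non-Cauchyness of a sequence in `X*`: the supremum over the closed
unit ball of `X` of the oscillation of `x*_n(x)`. -/
noncomputable def deltaWeakStar {𝕜 X : Type*} [RCLike 𝕜] [NormedAddCommGroup X] [NormedSpace 𝕜 X]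
    (ξ : ℕ → StrongDual 𝕜 X) : ℝ≥0∞ :=
  ⨆ (x : X) (_ : ‖x‖ ≤ 1), seqOsc fun n => ξ n x

/-- A Banach space `X` over `𝕜` is `c`-Grothendieck (for a constant `c ≥ 1`) if
`deltaWeak ξ ≤ c * deltaWeakStar ξ` for every norm bounded sequence `ξ` in `X*`. -/
def IsGrothendieckWith (𝕜 : Type*) [RCLike 𝕜] (c : ℝ≥0) (X : Type*) [NormedAddCommGroup X]
    [NormedSpace 𝕜 X] [CompleteSpace X] : Prop :=
  ∀ ξ : ℕ → StrongDual 𝕜 X, Bornology.IsBounded (Set.range ξ) →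
    deltaWeak ξ ≤ (c : ℝ≥0∞) * deltaWeakStar ξ

/-! Differences of the given functionals, rotated by unimodular scalars, form a bounded sequence y_n
on which some F in the bidual ball has real part at least c. By Helly (`exists_norm_le_one_approx`),
for each n one point of the unit ball is nearly as good for y_0, ..., y_n at once. It remains to
find a single x in the ball that is nearly as good for infinitely many n
(`exists_frequently_large`). Bounded measurable functions can be cut and pasted along measurable
sets, and there the modulus |y_n| is a finitely additive mass; let L be the limit of |y_n| along a
free ultrafilter.

Local step: the points good for y_0, ..., y_n form decreasing convex sets, so a nearly L²(L)-minimal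
h is L²(L)-close to each of them. A point g good for y_k thus differs from h substantially only on a
set B of small L-mass. What |y_k| can put on such sets is almost exhausted by sets A of arbitrarily
small L-mass (`exists_concentration`). Replacing h on A by a function nearly norming |y_k| there
does almost as well as g.

Gluing: sets of small L-mass are small for most later |y_k|, and a Rosenthal thinning makes the
later disjoint pieces small for the earlier ones. Pasting all modifications into h therefore costs
only ε (`exists_glue`). -/

open Filter Topology Set

/-! ### Finitely additive masses and their ultrafilter limits -/

section MassFunctional

variable {α : Type*} [MeasurableSpace α]

/-- Bounded nonnegative measurable functions. -/
structure IsWeight (p : α → ℝ) : Prop where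
  measurable : Measurable p
  nonneg : ∀ a, 0 ≤ p a
  bdd : ∃ C, 0 ≤ C ∧ ∀ a, p a ≤ C

theorem IsWeight.add {p q : α → ℝ} (hp : IsWeight p) (hq : IsWeight q) : IsWeight (p + q) := by
  obtain ⟨C, hC0, hC⟩ := hp.bdd
  obtain ⟨D, hD0, hD⟩ := hq.bdd
  exact ⟨hp.measurable.add hq.measurable, fun a => add_nonneg (hp.nonneg a) (hq.nonneg a),
    C + D, add_nonneg hC0 hD0, fun a => add_le_add (hC a) (hD a)⟩

theorem IsWeight.smul {p : α → ℝ} (hp : IsWeight p) {t : ℝ} (ht : 0 ≤ t) : IsWeight (t • p) := by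
  obtain ⟨C, hC0, hC⟩ := hp.bdd
  exact ⟨hp.measurable.const_smul t, fun a => mul_nonneg ht (hp.nonneg a),
    t * C, mul_nonneg ht hC0, fun a => mul_le_mul_of_nonneg_left (hC a) ht⟩

theorem IsWeight.indicator_one {A : Set α} (hA : MeasurableSet A) :
    IsWeight (A.indicator (1 : α → ℝ)) :=
  ⟨measurable_one.indicator hA, fun a => indicator_nonneg (fun _ _ => zero_le_one) a,
    1, zero_le_one, fun a => indicator_le_self' (fun _ _ => zero_le_one) a⟩

/-- Positive, additive, homogeneous functionals of mass at most `M` on the cone of bounded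
nonnegative measurable functions. -/
structure IsMassFunctional (M : ℝ) (N : (α → ℝ) → ℝ) : Prop where
  nonneg : ∀ p, IsWeight p → 0 ≤ N p
  mono : ∀ p q, IsWeight p → IsWeight q → (∀ a, p a ≤ q a) → N p ≤ N q
  add : ∀ p q, IsWeight p → IsWeight q → N (p + q) = N p + N q
  smul : ∀ t p, 0 ≤ t → IsWeight p → N (t • p) = t * N p
  le : ∀ p C, IsWeight p → 0 ≤ C → (∀ a, p a ≤ C) → N p ≤ M * C

/-- The finitely additive set function of a functional on weights. -/
noncomputable def massOf (N : (α → ℝ) → ℝ) (A : Set α) : ℝ := N (A.indicator 1)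

variable {M : ℝ} {N : (α → ℝ) → ℝ}

theorem IsMassFunctional.massOf_nonneg (hN : IsMassFunctional M N) {A : Set α}
    (hA : MeasurableSet A) : 0 ≤ massOf N A := hN.nonneg _ (.indicator_one hA)

theorem IsMassFunctional.massOf_le (hN : IsMassFunctional M N) {A : Set α}
    (hA : MeasurableSet A) : massOf N A ≤ M := by
  simpa [massOf] using hN.le _ 1 (.indicator_one hA) zero_le_one
    (fun a => indicator_le_self' (fun _ _ => zero_le_one) a)

theorem IsMassFunctional.massOf_mono (hN : IsMassFunctional M N) {A B : Set α}
    (hA : MeasurableSet A) (hB : MeasurableSet B) (h : A ⊆ B) : massOf N A ≤ massOf N B :=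
  hN.mono _ _ (.indicator_one hA) (.indicator_one hB)
    (fun a => indicator_le_indicator_of_subset h (fun _ => zero_le_one) a)

theorem IsMassFunctional.massOf_union (hN : IsMassFunctional M N) {A B : Set α}
    (hA : MeasurableSet A) (hB : MeasurableSet B) (h : Disjoint A B) :
    massOf N (A ∪ B) = massOf N A + massOf N B := by
  rw [massOf, indicator_union_of_disjoint h]
  exact hN.add _ _ (.indicator_one hA) (.indicator_one hB)

theorem IsMassFunctional.massOf_union_le (hN : IsMassFunctional M N) {A B : Set α}
    (hA : MeasurableSet A) (hB : MeasurableSet B) :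
    massOf N (A ∪ B) ≤ massOf N A + massOf N B := by
  rw [← union_sdiff_self, hN.massOf_union hA (hB.diff hA) disjoint_sdiff_right]
  exact add_le_add le_rfl (hN.massOf_mono (hB.diff hA) hB sdiff_subset)

theorem IsMassFunctional.massOf_empty (hN : IsMassFunctional M N) : massOf N ∅ = 0 := by
  have := hN.massOf_union MeasurableSet.empty MeasurableSet.empty (disjoint_empty _)
  simpa using this

theorem IsMassFunctional.massOf_biUnion_le (hN : IsMassFunctional M N) {A : ℕ → Set α}
    (hA : ∀ i, MeasurableSet (A i)) (n : ℕ) :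
    massOf N (⋃ i < n, A i) ≤ ∑ i ∈ Finset.range n, massOf N (A i) := by
  induction n with
  | zero => simp [hN.massOf_empty]
  | succ n ih =>
    rw [biUnion_lt_succ, Finset.sum_range_succ]
    exact (hN.massOf_union_le (.biUnion (to_countable _) fun i _ => hA i) (hA n)).trans
      (add_le_add ih le_rfl)

theorem IsMassFunctional.chebyshev (hN : IsMassFunctional M N) {p : α → ℝ} (hp : IsWeight p)
    {t : ℝ} (ht : 0 ≤ t) : t * massOf N {a | t < p a} ≤ N p := by
  have hm : MeasurableSet {a | t < p a} := measurableSet_lt measurable_const hp.measurable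
  rw [massOf, ← hN.smul t _ ht (.indicator_one hm)]
  refine hN.mono _ _ ((IsWeight.indicator_one hm).smul ht) hp fun a => ?_
  by_cases h : t < p a
  · simp [h, h.le]
  · simp [h, hp.nonneg a]

/-- The limit of a bounded sequence of mass functionals along an ultrafilter is a mass
functional. -/
theorem exists_ultrafilter_limit {N : ℕ → (α → ℝ) → ℝ} (hN : ∀ n, IsMassFunctional M (N n))
    (ω : Ultrafilter ℕ) : ∃ L : (α → ℝ) → ℝ, IsMassFunctional M L ∧
      ∀ p, IsWeight p → Tendsto (fun n => N n p) ω (𝓝 (L p)) := by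
  have key : ∀ p : α → ℝ, ∃ l, IsWeight p → Tendsto (fun n => N n p) ω (𝓝 l) := by
    intro p
    by_cases hp : IsWeight p
    · obtain ⟨C, hC0, hC⟩ := hp.bdd
      obtain ⟨l, -, hl⟩ := (isCompact_Icc (a := (0 : ℝ)) (b := M * C)).ultrafilter_le_nhds'
        (ω.map fun n => N n p) (Ultrafilter.mem_map.2 <| Filter.univ_mem' fun n =>
          ⟨(hN n).nonneg p hp, (hN n).le p C hp hC0 hC⟩)
      exact ⟨l, fun _ => hl⟩
    · exact ⟨0, fun h => absurd h hp⟩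
  choose L hL using key
  refine ⟨L, ⟨fun p hp => ?_, fun p q hp hq h => ?_, fun p q hp hq => ?_, fun t p ht hp => ?_,
    fun p C hp hC0 hC => ?_⟩, hL⟩
  · exact ge_of_tendsto' (hL p hp) fun n => (hN n).nonneg p hp
  · exact le_of_tendsto_of_tendsto' (hL p hp) (hL q hq) fun n => (hN n).mono p q hp hq h
  · refine tendsto_nhds_unique (hL _ (hp.add hq)) (((hL p hp).add (hL q hq)).congr fun n => ?_)
    exact ((hN n).add p q hp hq).symm
  · refine tendsto_nhds_unique (hL _ (hp.smul ht)) (((hL p hp).const_mul t).congr fun n => ?_)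
    exact ((hN n).smul t p ht hp).symm
  · exact le_of_tendsto' (hL p hp) fun n => (hN n).le p C hp hC0 hC

end MassFunctional

/-! ### The modulus of a functional -/

section Modulus

variable {α : Type*} [MeasurableSpace α] {𝕜 : Type*} [RCLike 𝕜]

/-- A functional whose restriction to bounded measurable functions has norm at most `M`. -/
def IsBoundedFunctional (M : ℝ) (y : (α → 𝕜) →ₗ[𝕜] 𝕜) : Prop :=
  ∀ f, Measurable f → ∀ C, 0 ≤ C → (∀ a, ‖f a‖ ≤ C) → ‖y f‖ ≤ M * C

/-- The modulus of a functional on bounded measurable functions, evaluated at a weight. -/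
noncomputable def modulus (y : (α → 𝕜) →ₗ[𝕜] 𝕜) (p : α → ℝ) : ℝ :=
  sSup {r | ∃ f, Measurable f ∧ (∀ a, ‖f a‖ ≤ p a) ∧ ‖y f‖ = r}

variable {M : ℝ} {y : (α → 𝕜) →ₗ[𝕜] 𝕜}

theorem norm_le_modulus (hy : IsBoundedFunctional M y) {p : α → ℝ} (hp : IsWeight p) {f : α → 𝕜}
    (hf : Measurable f) (hfp : ∀ a, ‖f a‖ ≤ p a) : ‖y f‖ ≤ modulus y p := by
  obtain ⟨C, hC0, hC⟩ := hp.bdd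
  refine le_csSup ⟨M * C, ?_⟩ ⟨f, hf, hfp, rfl⟩
  rintro r ⟨g, hg, hgp, rfl⟩
  exact hy g hg C hC0 fun a => (hgp a).trans (hC a)

theorem modulus_le {p : α → ℝ} (hp : IsWeight p) {B : ℝ}
    (h : ∀ f, Measurable f → (∀ a, ‖f a‖ ≤ p a) → ‖y f‖ ≤ B) : modulus y p ≤ B := by
  refine csSup_le ⟨_, 0, measurable_zero, fun a => by simpa using hp.nonneg a, rfl⟩ ?_
  rintro r ⟨g, hg, hgp, rfl⟩
  exact h g hg hgp

theorem exists_unimodular_mul_eq_norm (z : 𝕜) : ∃ u : 𝕜, ‖u‖ = 1 ∧ u * z = (‖z‖ : 𝕜) := by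
  rcases eq_or_ne z 0 with rfl | hz
  · exact ⟨1, by simp, by simp⟩
  · have hn : (‖z‖ : 𝕜) ≠ 0 := by simpa using hz
    refine ⟨(starRingEnd 𝕜 z) / ‖z‖, ?_, ?_⟩
    · simp [hz]
    · rw [div_mul_eq_mul_div, RCLike.conj_mul, pow_two, mul_div_assoc, div_self hn, mul_one]

/-- The modulus at a weight is approximated by values that are real and positive. -/
theorem exists_re_gt_of_lt_modulus {p : α → ℝ} (hp : IsWeight p) {B : ℝ} (h : B < modulus y p) :
    ∃ f, Measurable f ∧ (∀ a, ‖f a‖ ≤ p a) ∧ B < RCLike.re (y f) := by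
  obtain ⟨_, ⟨f, hf, hfp, rfl⟩, hB⟩ := exists_lt_of_lt_csSup
    (s := {r | ∃ f, Measurable f ∧ (∀ a, ‖f a‖ ≤ p a) ∧ ‖y f‖ = r})
    ⟨_, 0, measurable_zero, fun a => by simpa using hp.nonneg a, rfl⟩ h
  obtain ⟨u, hu, huy⟩ := exists_unimodular_mul_eq_norm (y f)
  refine ⟨u • f, hf.const_smul u, fun a => by simpa [hu] using hfp a, ?_⟩
  rw [map_smul, smul_eq_mul, huy]
  simpa using hB

/-- Riesz decomposition: a competitor f for p + q splits into f p/(p + q) and f q/(p + q),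
competitors for p and for q. -/
theorem modulus_add_le (hy : IsBoundedFunctional M y) {p q : α → ℝ} (hp : IsWeight p)
    (hq : IsWeight q) : modulus y (p + q) ≤ modulus y p + modulus y q := by
  refine modulus_le (hp.add hq) fun f hf hfpq => ?_
  have part : ∀ r : α → ℝ, IsWeight r → (∀ a, r a ≤ p a + q a) →
      ‖y (fun a => f a * ((r a / (p a + q a) : ℝ) : 𝕜))‖ ≤ modulus y r := by
    intro r hr hle
    refine norm_le_modulus hy hr (hf.mul ?_) fun a => ?_
    · exact RCLike.measurable_ofReal.comp
        (hr.measurable.div (hp.measurable.add hq.measurable))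
    · have h0 : 0 ≤ p a + q a := add_nonneg (hp.nonneg a) (hq.nonneg a)
      rw [norm_mul, RCLike.norm_ofReal, abs_of_nonneg (div_nonneg (hr.nonneg a) h0)]
      refine (mul_le_mul_of_nonneg_right (hfpq a) (div_nonneg (hr.nonneg a) h0)).trans ?_
      rcases h0.eq_or_lt with h | h
      · simp [← h, hr.nonneg a]
      · rw [Pi.add_apply, mul_div_cancel₀ _ h.ne']
  have hsum : f = (fun a => f a * ((p a / (p a + q a) : ℝ) : 𝕜)) +
      fun a => f a * ((q a / (p a + q a) : ℝ) : 𝕜) := by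
    funext a
    rw [Pi.add_apply, ← mul_add, ← RCLike.ofReal_add, ← add_div]
    -- Where p + q vanishes both quotients are 0 by convention, but f vanishes there too.
    rcases eq_or_ne (p a + q a) 0 with h | h
    · have : f a = 0 := by simpa [h] using hfpq a
      simp [this]
    · simp [div_self h]
  rw [hsum, map_add]
  exact (norm_add_le _ _).trans (add_le_add
    (part p hp fun a => le_add_of_nonneg_right (hq.nonneg a))
    (part q hq fun a => le_add_of_nonneg_left (hp.nonneg a)))

/-- Competitors for p and q can be rotated to have real parts near the two moduli, and real parts
add without cancellation. -/
theorem le_modulus_add (hy : IsBoundedFunctional M y) {p q : α → ℝ} (hp : IsWeight p)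
    (hq : IsWeight q) : modulus y p + modulus y q ≤ modulus y (p + q) := by
  refine le_of_forall_pos_lt_add fun ε hε => ?_
  obtain ⟨f, hf, hfp, hf'⟩ := exists_re_gt_of_lt_modulus (y := y) hp
    (show modulus y p - ε / 2 < _ by linarith)
  obtain ⟨g, hg, hgq, hg'⟩ := exists_re_gt_of_lt_modulus (y := y) hq
    (show modulus y q - ε / 2 < _ by linarith)
  have h1 := norm_le_modulus hy (hp.add hq) (hf.add hg)
    fun a => (norm_add_le _ _).trans (add_le_add (hfp a) (hgq a))
  have h2 := RCLike.re_le_norm (y (f + g))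
  rw [map_add, map_add] at h2
  rw [map_add] at h1
  linarith

theorem modulus_smul_le {t : ℝ} (ht : 0 < t) (hy : IsBoundedFunctional M y) {p : α → ℝ}
    (hp : IsWeight p) : modulus y (t • p) ≤ t * modulus y p := by
  refine modulus_le (hp.smul ht.le) fun f hf hfp => ?_
  have := norm_le_modulus hy hp (hf.const_smul ((t⁻¹ : ℝ) : 𝕜)) fun a => by
    rw [Pi.smul_apply, norm_smul, RCLike.norm_ofReal, abs_of_pos (inv_pos.2 ht),
      inv_mul_le_iff₀ ht]
    exact hfp a
  rwa [map_smul, norm_smul, RCLike.norm_ofReal, abs_of_pos (inv_pos.2 ht),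
    inv_mul_le_iff₀ ht] at this

theorem isMassFunctional_modulus (hy : IsBoundedFunctional M y) :
    IsMassFunctional M (modulus y) where
  nonneg p hp := (norm_nonneg _).trans
    (norm_le_modulus hy hp measurable_zero fun a => by simpa using hp.nonneg a)
  mono p q hp hq h := modulus_le hp fun f hf hfp =>
    norm_le_modulus hy hq hf fun a => (hfp a).trans (h a)
  add p q hp hq := (modulus_add_le hy hp hq).antisymm (le_modulus_add hy hp hq)
  smul t p ht hp := by
    rcases ht.eq_or_lt with rfl | ht
    · have h0 : IsWeight (0 : α → ℝ) := ⟨measurable_zero, fun _ => le_rfl, 0, le_rfl, fun _ => le_rfl⟩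
      have h1 := modulus_add_le hy h0 h0
      have h2 := le_modulus_add hy h0 h0
      rw [add_zero] at h1 h2
      rw [zero_smul, zero_mul]
      linarith
    · refine (modulus_smul_le ht hy hp).antisymm ?_
      have := modulus_smul_le (inv_pos.2 ht) hy (hp.smul ht.le)
      rwa [smul_smul, inv_mul_cancel₀ ht.ne', one_smul, le_inv_mul_iff₀ ht] at this
  le p C hp hC0 hC := modulus_le hp fun f hf hfp =>
    hy f hf C hC0 fun a => (hfp a).trans (hC a)

/-- A function of norm at most `1` vanishing off `A` has value at most the mass of `A`. -/
theorem norm_le_massOf (hy : IsBoundedFunctional M y) {A : Set α} (hA : MeasurableSet A)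
    {C : ℝ} (hC : 0 ≤ C) {f : α → 𝕜} (hf : Measurable f) (h1 : ∀ a, ‖f a‖ ≤ C)
    (h0 : ∀ a ∉ A, f a = 0) : ‖y f‖ ≤ C * massOf (modulus y) A := by
  rw [massOf, ← (isMassFunctional_modulus hy).smul C _ hC (.indicator_one hA)]
  refine norm_le_modulus hy ((IsWeight.indicator_one hA).smul hC) hf fun a => ?_
  by_cases h : a ∈ A
  · simpa [h] using h1 a
  · simp [h, h0 a h]

end Modulus

/-! ### Rosenthal thinning and gluing of local modifications -/

section Gluing

/-- A superadditive bounded set function on `ℕ` is small on some infinite subset. -/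
theorem exists_infinite_subset_lt {W : Set ℕ → ℝ} {M : ℝ} (h0 : ∀ P, 0 ≤ W P) (hM : ∀ P, W P ≤ M)
    (hadd : ∀ P Q, Disjoint P Q → W P + W Q ≤ W (P ∪ Q)) {P : Set ℕ} (hP : P.Infinite)
    {ε : ℝ} (hε : 0 < ε) : ∃ Q ⊆ P, Q.Infinite ∧ W Q < ε := by
  by_contra! hcon
  -- If every infinite subset carried at least ε, splitting off infinite halves n times would give n
  -- ε, which eventually exceeds M.
  have key : ∀ n : ℕ, ∀ Q ⊆ P, Q.Infinite → n * ε ≤ W Q := by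
    intro n
    induction n with
    | zero => intro Q _ _; simpa using h0 Q
    | succ n ih =>
      intro Q hQP hQ
      obtain ⟨A, B, hAB, hdisj, hcard⟩ := hQ.exists_union_disjoint_cardinal_eq_of_infinite
      obtain ⟨e⟩ := Cardinal.eq.1 hcard
      have hiff : A.Infinite ↔ B.Infinite := by
        rw [← infinite_coe_iff, ← infinite_coe_iff, e.infinite_iff]
      have hor : A.Infinite ∨ B.Infinite := infinite_union.1 (hAB ▸ hQ)
      have hA' : A.Infinite := hor.elim id hiff.2
      have hB' : B.Infinite := hor.elim hiff.1 id
      have h1 := ih A ((hAB ▸ subset_union_left).trans hQP) hA'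
      have h2 := hcon B ((hAB ▸ subset_union_right).trans hQP) hB'
      have h3 := hadd A B hdisj
      rw [hAB] at h3
      push_cast
      linarith
  obtain ⟨n, hn⟩ := exists_nat_gt (M / ε)
  have h1 := key n P subset_rfl hP
  have h2 := hM P
  rw [div_lt_iff₀ hε] at hn
  linarith

/-- A form of Rosenthal's lemma. -/
theorem exists_strictMono_tail_lt {W : ℕ → Set ℕ → ℝ} {M : ℝ} (h0 : ∀ n P, 0 ≤ W n P)
    (hM : ∀ n P, W n P ≤ M) (hmono : ∀ n P Q, P ⊆ Q → W n P ≤ W n Q)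
    (hadd : ∀ n P Q, Disjoint P Q → W n P + W n Q ≤ W n (P ∪ Q)) {ε : ℝ} (hε : 0 < ε) :
    ∃ φ : ℕ → ℕ, StrictMono φ ∧ ∀ j, W (φ j) (φ '' Ioi j) < ε := by
  -- The least element of P becomes the next index; the rest of P shrinks to an infinite set, small
  -- for that index, from which all later indices come.
  have step : ∀ P : {P : Set ℕ // P.Infinite}, ∃ Q : {P : Set ℕ // P.Infinite},
      Q.1 ⊆ P.1 ∩ Ioi (sInf P.1) ∧ W (sInf P.1) Q.1 < ε := by
    rintro ⟨P, hP⟩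
    have hP' : (P ∩ Ioi (sInf P)).Infinite := by
      refine (hP.sdiff (finite_Iic (sInf P))).mono fun x hx => ⟨hx.1, ?_⟩
      exact mem_Ioi.2 (not_le.1 fun h => hx.2 (mem_Iic.2 h))
    obtain ⟨Q, hQP, hQ, hW⟩ := exists_infinite_subset_lt (h0 (sInf P)) (hM _) (hadd _)
      hP' hε
    exact ⟨⟨Q, hQ⟩, hQP, hW⟩
  choose next hnext hW using step
  let S : ℕ → {P : Set ℕ // P.Infinite} := fun n => next^[n] ⟨univ, infinite_univ⟩
  have hS : ∀ n, S (n + 1) = next (S n) := fun n => Function.iterate_succ_apply' _ _ _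
  have hmem : ∀ n, sInf (S n).1 ∈ (S n).1 := fun n => Nat.sInf_mem (S n).2.nonempty
  have hanti : Antitone fun n => (S n).1 := antitone_nat_of_succ_le fun n => by
    rw [hS]; exact (hnext _).trans inter_subset_left
  refine ⟨fun n => sInf (S n).1, strictMono_nat_of_lt_succ fun n => ?_, fun j => ?_⟩
  · have := hmem (n + 1)
    rw [hS n] at this
    rw [hS n]
    exact (hnext _ this).2
  · refine (hmono _ _ (S (j + 1)).1 ?_).trans_lt ((hS j).symm ▸ hW (S j))
    rintro _ ⟨i, hi, rfl⟩
    exact hanti (Nat.succ_le_of_lt hi) (hmem i)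

variable {α : Type*} [MeasurableSpace α] {𝕜 : Type*} [RCLike 𝕜]

/-- Local modifications of `h`, on sets whose mass for the limit functional is arbitrarily small,
can be glued along a subsequence. -/
theorem exists_glue {M : ℝ} {y : ℕ → (α → 𝕜) →ₗ[𝕜] 𝕜} (hy : ∀ n, IsBoundedFunctional M (y n))
    {ω : Ultrafilter ℕ} (hω : (ω : Filter ℕ) ≤ atTop) {L : (α → ℝ) → ℝ}
    (hlim : ∀ p, IsWeight p → Tendsto (fun n => modulus (y n) p) ω (𝓝 (L p)))
    {h : α → 𝕜} (hh : Measurable h) (hh1 : ∀ a, ‖h a‖ ≤ 1) {c : ℝ}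
    (hloc : ∀ δ > 0, ∀ᶠ k in (ω : Filter ℕ), ∃ (A : Set α) (z : α → 𝕜), MeasurableSet A ∧
      massOf L A < δ ∧ Measurable z ∧ (∀ a, ‖z a‖ ≤ 1) ∧ (∀ a ∉ A, z a = h a) ∧
      c ≤ RCLike.re (y k z)) {ε : ℝ} (hε : 0 < ε) :
    ∃ x : α → 𝕜, Measurable x ∧ (∀ a, ‖x a‖ ≤ 1) ∧
      ∃ᶠ n in atTop, c - ε ≤ RCLike.re (y n x) := by
  have hN := fun n => isMassFunctional_modulus (hy n)
  set η : ℝ := ε / 6 with hη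
  have hη0 : 0 < η := by positivity
  -- choose the modifications one after the other
  let good : ℕ × ℕ × Set α × (α → 𝕜) → Prop := fun t =>
    MeasurableSet t.2.2.1 ∧ massOf L t.2.2.1 < η * (1 / 2) ^ t.2.1 ∧
      Measurable t.2.2.2 ∧ (∀ a, ‖t.2.2.2 a‖ ≤ 1) ∧ (∀ a ∉ t.2.2.1, t.2.2.2 a = h a) ∧
      c ≤ RCLike.re (y t.1 t.2.2.2)
  -- The second component is a counter: strictly increasing along the sequence, hence at least n at
  -- position n, so that the masses of the earlier sets sum geometrically.
  let rel : ℕ × ℕ × Set α × (α → 𝕜) → ℕ × ℕ × Set α × (α → 𝕜) → Prop := fun s t =>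
    s.1 < t.1 ∧ s.2.1 < t.2.1 ∧ massOf (modulus (y t.1)) s.2.2.1 < η * (1 / 2) ^ s.2.1
  obtain ⟨f, hf, hfr⟩ : ∃ f : ℕ → ℕ × ℕ × Set α × (α → 𝕜), (∀ n, good (f n)) ∧
      ∀ m n, m < n → rel (f m) (f n) := by
    refine exists_seq_of_forall_finset_exists good rel fun s hs => ?_
    -- The |y_k|-mass of an earlier set tends along ω to its L-mass, which is already below the
    -- bound.
    have e1 : ∀ᶠ k in (ω : Filter ℕ), ∀ t ∈ s,
        massOf (modulus (y k)) t.2.2.1 < η * (1 / 2) ^ t.2.1 :=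
      (Filter.eventually_all_finset s).2 fun t ht =>
        (hlim _ (.indicator_one (hs t ht).1)).eventually_lt_const (hs t ht).2.1
    have e2 : ∀ᶠ k in (ω : Filter ℕ), ∀ t ∈ s, t.1 < k :=
      (Filter.eventually_all_finset s).2 fun t _ => hω (eventually_gt_atTop t.1)
    set J := s.sup (fun t => t.2.1) + 1 with hJ
    obtain ⟨k, ⟨A, z, hA, hAL, hz⟩, h1, h2⟩ :=
      ((hloc (η * (1 / 2) ^ J) (by positivity)).and (e1.and e2)).exists
    exact ⟨(k, J, A, z), ⟨hA, hAL, hz⟩, fun t ht => ⟨h2 t ht,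
      Nat.lt_succ_of_le (Finset.le_sup (f := fun t : ℕ × ℕ × Set α × (α → 𝕜) => t.2.1) ht),
      h1 t ht⟩⟩
  set k : ℕ → ℕ := fun n => (f n).1 with hk
  set A : ℕ → Set α := fun n => (f n).2.2.1 with hAdef
  set z : ℕ → α → 𝕜 := fun n => (f n).2.2.2 with hzdef
  have hkmono : StrictMono k := fun m n hmn => (hfr m n hmn).1
  have hjmono : StrictMono fun n => (f n).2.1 := fun m n hmn => (hfr m n hmn).2.1
  have hA : ∀ n, MeasurableSet (A n) := fun n => (hf n).1
  have hz : ∀ n, Measurable (z n) := fun n => (hf n).2.2.1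
  have hz1 : ∀ n a, ‖z n a‖ ≤ 1 := fun n => (hf n).2.2.2.1
  have hzh : ∀ n, ∀ a ∉ A n, z n a = h a := fun n => (hf n).2.2.2.2.1
  have hc : ∀ n, c ≤ RCLike.re (y (k n) (z n)) := fun n => (hf n).2.2.2.2.2
  have hpre : ∀ n, massOf (modulus (y (k n))) (⋃ i < n, A i) ≤ 2 * η := by
    intro n
    refine ((hN (k n)).massOf_biUnion_le hA n).trans ?_
    calc ∑ i ∈ Finset.range n, massOf (modulus (y (k n))) (A i)
        ≤ ∑ i ∈ Finset.range n, η * (1 / 2) ^ i := by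
          refine Finset.sum_le_sum fun i hi => ((hfr i n (Finset.mem_range.1 hi)).2.2.le).trans ?_
          exact mul_le_mul_of_nonneg_left
            (pow_le_pow_of_le_one (by norm_num) (by norm_num) (hjmono.le_apply)) hη0.le
      _ = η * ∑ i ∈ Finset.range n, (1 / 2 : ℝ) ^ i := by rw [Finset.mul_sum]
      _ ≤ η * 2 := mul_le_mul_of_nonneg_left (sum_geometric_two_le n) hη0.le
      _ = 2 * η := mul_comm _ _
  -- disjoint pieces, thinned out
  set D : ℕ → Set α := disjointed A with hD
  have hDm : ∀ n, MeasurableSet (D n) := fun n => MeasurableSet.disjointed hA n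
  have hDdisj : Pairwise (Function.onFun Disjoint D) := disjoint_disjointed A
  have hDA : ∀ n, D n ⊆ A n := fun n => disjointed_subset A n
  have hUm : ∀ P : Set ℕ, MeasurableSet (⋃ i ∈ P, D i) :=
    fun P => .biUnion (to_countable P) fun i _ => hDm i
  obtain ⟨φ, hφ, hφtail⟩ := exists_strictMono_tail_lt
    (W := fun n P => massOf (modulus (y (k n))) (⋃ i ∈ P, D i)) (M := M)
    (fun n P => (hN _).massOf_nonneg (hUm P)) (fun n P => (hN _).massOf_le (hUm P))
    (fun n P Q hPQ => (hN _).massOf_mono (hUm P) (hUm Q) (biUnion_subset_biUnion_left hPQ))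
    (fun n P Q hPQ => by
      rw [biUnion_union, (hN _).massOf_union (hUm P) (hUm Q)]
      simp only [disjoint_iUnion_left, disjoint_iUnion_right]
      exact fun i hi j hj => hDdisj fun h => disjoint_left.1 hPQ hj (by rwa [h])) hη0
  obtain ⟨x, hx, hxE⟩ := exists_measurable_piecewise
    (fun o : Option ℕ => o.elim (⋃ j, D (φ j))ᶜ fun j => D (φ j))
    (by rintro (_ | j); exacts [(MeasurableSet.iUnion fun j => hDm _).compl, hDm _])
    (fun o : Option ℕ => o.elim h fun j => z (φ j))
    (by rintro (_ | j); exacts [hh, hz _])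
    (by
      rintro (_ | i) (_ | j) hij a ⟨ha1, ha2⟩
      · rfl
      · exact absurd (mem_iUnion.2 ⟨j, ha2⟩) ha1
      · exact absurd (mem_iUnion.2 ⟨i, ha1⟩) ha2
      · exact absurd ha2 (disjoint_left.1 (hDdisj (hφ.injective.ne fun h => hij (by rw [h]))) ha1))
  have hxh : ∀ a, a ∉ (⋃ j, D (φ j)) → x a = h a := fun a ha => hxE none ha
  have hxz : ∀ j, ∀ a ∈ D (φ j), x a = z (φ j) a := fun j a ha => hxE (some j) ha
  have hx1 : ∀ a, ‖x a‖ ≤ 1 := by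
    intro a
    by_cases ha : a ∈ ⋃ j, D (φ j)
    · obtain ⟨j, hj⟩ := mem_iUnion.1 ha
      rw [hxz j a hj]; exact hz1 _ a
    · rw [hxh a ha]; exact hh1 a
  refine ⟨x, hx, hx1, ?_⟩
  have hval : ∀ j, c - ε ≤ RCLike.re (y (k (φ j)) x) := by
    intro j
    -- Off B, x agrees with z (φ j). On B they differ by at most 2, and B has mass at most 3η, so
    -- the error is at most 6η = ε.
    set B : Set α := (⋃ i < φ j, A i) ∪ ⋃ i ∈ φ '' Ioi j, D i with hB
    have hm1 : MeasurableSet (⋃ i < φ j, A i) := .biUnion (to_countable _) fun i _ => hA i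
    have hBm : MeasurableSet B := hm1.union (hUm _)
    have hmass : massOf (modulus (y (k (φ j)))) B ≤ 3 * η := by
      have := (hN (k (φ j))).massOf_union_le hm1 (hUm (φ '' Ioi j))
      have h1 := hpre (φ j)
      have h2 := hφtail j
      linarith
    have hdiff := norm_le_massOf (hy (k (φ j))) hBm (C := 2) (by norm_num) ((hz (φ j)).sub hx)
      (fun a => (norm_sub_le _ _).trans (by linarith [hz1 (φ j) a, hx1 a])) (by
        intro a haB
        have ha1 : ∀ i < φ j, a ∉ A i := fun i hi h' =>
          haB (Or.inl (mem_biUnion (show i ∈ {i | i < φ j} from hi) h'))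
        rw [Pi.sub_apply, sub_eq_zero]
        by_cases haA : a ∈ A (φ j)
        · have : a ∈ D (φ j) := by
            rw [hD, disjointed_apply]
            refine ⟨haA, fun h' => ?_⟩
            simp only [Finset.sup_set_eq_biUnion, mem_iUnion, Finset.mem_Iio] at h'
            obtain ⟨i, hi, h'⟩ := h'
            exact ha1 i hi h'
          exact (hxz j a this).symm
        · rw [hzh _ a haA, hxh a]
          intro h'
          obtain ⟨i, hi⟩ := mem_iUnion.1 h'
          rcases lt_trichotomy i j with hij | rfl | hij
          · exact ha1 _ (hφ hij) (hDA _ hi)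
          · exact haA (hDA _ hi)
          · exact haB (Or.inr (mem_biUnion (mem_image_of_mem φ hij) hi)))
    rw [map_sub] at hdiff
    have h1 := RCLike.re_le_norm (y (k (φ j)) (z (φ j)) - y (k (φ j)) x)
    rw [map_sub] at h1
    have h2 := hc (φ j)
    linarith
  exact frequently_atTop.2 fun n => ⟨k (φ n), (hkmono.comp hφ).le_apply, hval n⟩

end Gluing

/-! ### Concentration, the L² argument and the local step -/

section Localization

variable {α : Type*} [MeasurableSpace α] {𝕜 : Type*} [RCLike 𝕜]

/-- The concentration `t` that the mass functionals `N n` asymptotically have on sets of small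
limit mass. -/
theorem exists_concentration {M : ℝ} {N : ℕ → (α → ℝ) → ℝ} (hN : ∀ n, IsMassFunctional M (N n))
    (ω : Ultrafilter ℕ) (L : (α → ℝ) → ℝ) (hL : IsMassFunctional M L) {ε : ℝ} (hε : 0 < ε) :
    ∃ t δ : ℝ, 0 < δ ∧
      (∀ᶠ k in (ω : Filter ℕ), ∀ A, MeasurableSet A → massOf L A < δ → massOf (N k) A < t + ε) ∧
      ∀ δ' > 0, ∀ᶠ k in (ω : Filter ℕ), ∃ A, MeasurableSet A ∧ massOf L A < δ' ∧
        t ≤ massOf (N k) A := by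
  set S : Set ℝ := {t | ∀ δ' > 0, ∀ᶠ k in (ω : Filter ℕ), ∃ A, MeasurableSet A ∧
    massOf L A < δ' ∧ t ≤ massOf (N k) A} with hS
  have hS0 : (0 : ℝ) ∈ S := fun δ' hδ' => Eventually.of_forall fun k =>
    ⟨∅, .empty, by rwa [hL.massOf_empty], ((hN k).massOf_empty).ge⟩
  have hSb : BddAbove S := by
    refine ⟨M, fun t ht => ?_⟩
    obtain ⟨k, A, hA, -, htA⟩ := (ht 1 one_pos).exists
    exact htA.trans ((hN k).massOf_le hA)
  -- With t within ε of sup S, t + ε is not in S; the ultrafilter turns this failure to hold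
  -- eventually into eventual failure.
  obtain ⟨t, htS, ht⟩ := exists_lt_of_lt_csSup ⟨0, hS0⟩ (sub_lt_self (sSup S) hε)
  have hnot : t + ε ∉ S := fun h => by linarith [le_csSup hSb h]
  simp only [hS, mem_ofPred_eq, not_forall] at hnot
  obtain ⟨δ, hδ, hnot⟩ := hnot
  refine ⟨t, δ, hδ, ?_, htS⟩
  filter_upwards [Ultrafilter.eventually_not.2 hnot] with k hk A hA hAδ
  exact not_le.1 fun h => hk ⟨A, hA, hAδ, h⟩

theorem IsWeight.norm_sq {f : α → 𝕜} (hf : Measurable f) {C : ℝ} (h : ∀ a, ‖f a‖ ≤ C) :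
    IsWeight fun a => ‖f a‖ ^ 2 :=
  ⟨hf.norm.pow_const 2, fun _ => sq_nonneg _, C ^ 2, sq_nonneg _, fun a =>
    pow_le_pow_left₀ (norm_nonneg _) (h a) 2⟩

/-- The pointwise parallelogram law passes through L by monotonicity and additivity; L(|f|²)^(1/2)
then supports the Hilbert space argument for minimal elements. -/
theorem IsMassFunctional.norm_sq_half_sub_le {M : ℝ} {L : (α → ℝ) → ℝ} (hL : IsMassFunctional M L)
    {f g : α → 𝕜} (hf : Measurable f) (hg : Measurable g) (hf1 : ∀ a, ‖f a‖ ≤ 1)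
    (hg1 : ∀ a, ‖g a‖ ≤ 1) :
    L (fun a => ‖f a - g a‖ ^ 2) + 4 * L (fun a => ‖((1 / 2 : ℝ) : 𝕜) * (f a + g a)‖ ^ 2) ≤
      2 * (L (fun a => ‖f a‖ ^ 2) + L fun a => ‖g a‖ ^ 2) := by
  have wf := IsWeight.norm_sq hf hf1
  have wg := IsWeight.norm_sq hg hg1
  have wd : IsWeight fun a => ‖f a - g a‖ ^ 2 := IsWeight.norm_sq (hf.sub hg) (C := 2)
    fun a => (norm_sub_le _ _).trans (by linarith [hf1 a, hg1 a])
  have ws : IsWeight fun a => ‖((1 / 2 : ℝ) : 𝕜) * (f a + g a)‖ ^ 2 :=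
    IsWeight.norm_sq ((hf.add hg).const_mul _) (C := 1) fun a => by
      rw [norm_mul, RCLike.norm_ofReal, abs_of_pos (by norm_num)]
      linarith [norm_add_le (f a) (g a), hf1 a, hg1 a]
  rw [← hL.smul 4 _ (by norm_num) ws, ← hL.add _ _ wd (ws.smul (by norm_num)), ← hL.add _ _ wf wg,
    ← hL.smul 2 _ (by norm_num) (wf.add wg)]
  refine hL.mono _ _ (wd.add (ws.smul (by norm_num))) ((wf.add wg).smul (by norm_num)) fun a => ?_
  simp only [Pi.add_apply, Pi.smul_apply, smul_eq_mul, norm_mul, RCLike.norm_ofReal]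
  rw [abs_of_pos (by norm_num : (0 : ℝ) < 1 / 2)]
  have := parallelogram_law_with_norm ℝ (f a) (g a)
  nlinarith

/-- The unit ball of bounded measurable functions. -/
def measurableUnitBall (α 𝕜 : Type*) [MeasurableSpace α] [RCLike 𝕜] : Set (α → 𝕜) :=
  {x | Measurable x ∧ ∀ a, ‖x a‖ ≤ 1}

/-- Elements far out in a decreasing sequence of convex sets can be chosen close in mass. -/
theorem exists_close_of_convex {M : ℝ} {L : (α → ℝ) → ℝ} (hL : IsMassFunctional M L)
    {C : ℕ → Set (α → 𝕜)} (hC : ∀ n, C n ⊆ measurableUnitBall α 𝕜) (hne : ∀ n, (C n).Nonempty)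
    (hanti : Antitone C)
    (hconv : ∀ n, ∀ f ∈ C n, ∀ g ∈ C n, (fun a => ((1 / 2 : ℝ) : 𝕜) * (f a + g a)) ∈ C n)
    {δ : ℝ} (hδ : 0 < δ) :
    ∃ h ∈ measurableUnitBall α 𝕜, ∀ n, ∃ g ∈ C n, L (fun a => ‖g a - h a‖ ^ 2) < δ := by
  set Q : (α → 𝕜) → ℝ := fun f => L fun a => ‖f a‖ ^ 2 with hQ
  have hQ0 : ∀ n, ∀ f ∈ C n, 0 ≤ Q f := fun n f hf =>
    hL.nonneg _ (.norm_sq (hC n hf).1 (hC n hf).2)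
  have hQM : ∀ n, ∀ f ∈ C n, Q f ≤ M := fun n f hf => by
    simpa using hL.le _ 1 (.norm_sq (hC n hf).1 (hC n hf).2) zero_le_one
      fun a => pow_le_one₀ (norm_nonneg _) ((hC n hf).2 a)
  set d : ℕ → ℝ := fun n => sInf (Q '' C n) with hd
  have hbb : ∀ n, BddBelow (Q '' C n) := fun n => ⟨0, by
    rintro _ ⟨f, hf, rfl⟩; exact hQ0 n f hf⟩
  have hdM : ∀ n, d n ≤ M := fun n => by
    obtain ⟨f, hf⟩ := hne n
    exact (csInf_le (hbb n) (mem_image_of_mem Q hf)).trans (hQM n f hf)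
  have hbd : BddAbove (range d) := ⟨M, by rintro _ ⟨n, rfl⟩; exact hdM n⟩
  -- The infima d n increase to a finite limit. Past m they vary by less than δ/8, and
  -- near-minimizers within δ/8, whose midpoint stays in C m, are at squared distance below 3δ/4.
  obtain ⟨m, hm⟩ := exists_lt_of_lt_ciSup (sub_lt_self (⨆ n, d n) (show 0 < δ / 8 by positivity))
  have pick : ∀ n, ∃ g ∈ C n, Q g < d n + δ / 8 := fun n => by
    obtain ⟨_, ⟨g, hg, rfl⟩, hlt⟩ := exists_lt_of_csInf_lt ((hne n).image Q)
      (show sInf (Q '' C n) < d n + δ / 8 from lt_add_of_pos_right _ (by positivity))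
    exact ⟨g, hg, hlt⟩
  obtain ⟨h, hh, hhQ⟩ := pick m
  refine ⟨h, hC m hh, fun n => ?_⟩
  obtain ⟨g, hg, hgQ⟩ := pick (max n m)
  refine ⟨g, hanti (le_max_left n m) hg, ?_⟩
  have hg' := hC _ hg
  have hpar := hL.norm_sq_half_sub_le hg'.1 (hC m hh).1 hg'.2 (hC m hh).2
  have hmid : d m ≤ Q fun a => ((1 / 2 : ℝ) : 𝕜) * (g a + h a) :=
    csInf_le (hbb m) (mem_image_of_mem Q (hconv m g (hanti (le_max_right n m) hg) h hh))
  have h1 : d (max n m) ≤ ⨆ n, d n := le_ciSup hbd _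
  have h2 : d m ≤ ⨆ n, d n := le_ciSup hbd _
  simp only [hQ] at hmid hgQ hhQ
  linarith

/-- The local step: a single function `h` has, for most `k`, a modification on a set of small limit
mass at which the `k`-th functional is large. -/
theorem exists_local_modification {M : ℝ} (hM : 0 ≤ M) {y : ℕ → (α → 𝕜) →ₗ[𝕜] 𝕜}
    (hy : ∀ n, IsBoundedFunctional M (y n)) (ω : Ultrafilter ℕ) {L : (α → ℝ) → ℝ}
    (hL : IsMassFunctional M L) {c : ℝ}
    (hc : ∀ n, ∃ x ∈ measurableUnitBall α 𝕜, ∀ i ≤ n, c ≤ RCLike.re (y i x))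
    {ε : ℝ} (hε : 0 < ε) :
    ∃ h ∈ measurableUnitBall α 𝕜, ∀ δ > 0, ∀ᶠ k in (ω : Filter ℕ), ∃ (A : Set α) (z : α → 𝕜),
      MeasurableSet A ∧ massOf L A < δ ∧ Measurable z ∧ (∀ a, ‖z a‖ ≤ 1) ∧
      (∀ a ∉ A, z a = h a) ∧ c - ε ≤ RCLike.re (y k z) := by
  have hN := fun n => isMassFunctional_modulus (hy n)
  -- The losses are η for norming on A, η for |y_k|(A) < t + η, 2η on B \ A and Mη off A ∪ B, within
  -- (5 + M)η.
  set η : ℝ := ε / (5 + M) with hη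
  have hη0 : 0 < η := by positivity
  have hηε : (5 + M) * η = ε := by rw [hη]; field_simp
  obtain ⟨t, δ₀, hδ₀, hup, hlow⟩ := exists_concentration hN ω L hL hη0
  obtain ⟨h, hh, hclose⟩ := exists_close_of_convex hL
    (C := fun n => {x | x ∈ measurableUnitBall α 𝕜 ∧ ∀ i ≤ n, c ≤ RCLike.re (y i x)})
    (fun n x hx => hx.1) hc (fun m n hmn x hx => ⟨hx.1, fun i hi => hx.2 i (hi.trans hmn)⟩)
    (fun n f hf g hg => by
      refine ⟨⟨(hf.1.1.add hg.1.1).const_mul _, fun a => ?_⟩, fun i hi => ?_⟩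
      · rw [norm_mul, RCLike.norm_ofReal, abs_of_pos (by norm_num)]
        linarith [norm_add_le (f a) (g a), hf.1.2 a, hg.1.2 a]
      · have : (fun a => ((1 / 2 : ℝ) : 𝕜) * (f a + g a)) = ((1 / 2 : ℝ) : 𝕜) • (f + g) := rfl
        rw [this, map_smul, map_add, smul_eq_mul, RCLike.re_ofReal_mul, map_add]
        linarith [hf.2 i hi, hg.2 i hi])
    -- By Chebyshev, this closeness gives the set where |g - h| > η an L-mass below δ₀/2.
    (show 0 < η ^ 2 * (δ₀ / 2) by positivity)
  refine ⟨h, hh, fun δ hδ => ?_⟩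
  filter_upwards [hup, hlow (min δ (δ₀ / 2)) (lt_min hδ (by positivity))] with k hk ⟨A, hA, hAL, htA⟩
  obtain ⟨g, ⟨hg, hgc⟩, hgh⟩ := hclose k
  have hgk := hgc k le_rfl
  -- the set where `g` and `h` differ substantially
  have wgh : IsWeight fun a => ‖g a - h a‖ ^ 2 := IsWeight.norm_sq (hg.1.sub hh.1) (C := 2)
    fun a => (norm_sub_le _ _).trans (by linarith [hg.2 a, hh.2 a])
  set B : Set α := {a | η ^ 2 < ‖g a - h a‖ ^ 2} with hB
  have hBm : MeasurableSet B := measurableSet_lt measurable_const wgh.measurable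
  have hBL : massOf L B < δ₀ / 2 := by
    have := (hL.chebyshev wgh (sq_nonneg η)).trans_lt hgh
    exact lt_of_mul_lt_mul_left this (sq_nonneg η)
  have hAB := hk (A ∪ B) (hA.union hBm) ((hL.massOf_union_le hA hBm).trans_lt (by
    linarith [hAL.trans_le (min_le_right δ (δ₀ / 2))]))
  have hA' := hk A hA (by linarith [hAL.trans_le (min_le_right δ (δ₀ / 2))])
  -- A alone carries at least t, while A ∪ B has L-mass below δ₀ and so carries less than t + η.
  -- Only δ₀, not δ, constrains B, so h does not depend on δ.
  have hBA : massOf (modulus (y k)) (B \ A) < η := by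
    rw [← union_sdiff_self, (hN k).massOf_union hA (hBm.diff hA) disjoint_sdiff_right] at hAB
    linarith
  -- a nearly norming function on `A`
  obtain ⟨f, hf, hfA, hfk⟩ := exists_re_gt_of_lt_modulus (y := y k) (.indicator_one hA)
    (show t - η < modulus (y k) (A.indicator 1) from by
      have : t ≤ modulus (y k) (A.indicator 1) := htA
      linarith)
  have hf0 : ∀ a ∉ A, f a = 0 := fun a ha => by simpa [ha] using hfA a
  have hf1 : ∀ a, ‖f a‖ ≤ 1 := fun a =>
    (hfA a).trans (indicator_le_self' (fun _ _ => zero_le_one) a)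
  have e1 := norm_le_massOf (hy k) hA zero_le_one (hg.1.indicator hA)
    (fun a => (norm_indicator_le_norm_self _ _).trans (hg.2 a))
    fun a ha => indicator_of_notMem ha _
  have e2 := norm_le_massOf (hy k) (hBm.diff hA) (C := 2) (by norm_num)
    ((hg.1.sub hh.1).indicator (hBm.diff hA))
    (fun a => (norm_indicator_le_norm_self _ _).trans
      ((norm_sub_le _ _).trans (by linarith [hg.2 a, hh.2 a])))
    fun a ha => indicator_of_notMem ha _
  have e3 := hy k _ ((hg.1.sub hh.1).indicator (hA.union hBm).compl) η hη0.le fun a => by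
    by_cases ha : a ∈ A ∪ B
    · rw [indicator_of_notMem (notMem_compl_iff.2 ha), norm_zero]
      exact hη0.le
    · rw [indicator_of_mem (mem_compl ha)]
      have : ¬ η ^ 2 < ‖g a - h a‖ ^ 2 := fun h' => ha (Or.inr h')
      exact (sq_le_sq₀ (norm_nonneg _) hη0.le).1 (not_lt.1 this)
  have hsplit : g = A.indicator g + (B \ A).indicator (g - h) + (A ∪ B)ᶜ.indicator (g - h) +
      Aᶜ.indicator h := by
    funext a
    by_cases ha : a ∈ A <;> by_cases hb : a ∈ B <;> simp [ha, hb]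
  refine ⟨A, f + Aᶜ.indicator h, hA, hAL.trans_le (min_le_left _ _),
    hf.add (hh.1.indicator hA.compl), fun a => ?_, fun a ha => ?_, ?_⟩
  · by_cases ha : a ∈ A
    · simpa [ha] using hf1 a
    · simpa [ha, hf0 a ha] using hh.2 a
  · simp [ha, hf0 a ha]
  · have hre : RCLike.re (y k g) = RCLike.re (y k (A.indicator g)) +
        RCLike.re (y k ((B \ A).indicator (g - h))) +
        RCLike.re (y k ((A ∪ B)ᶜ.indicator (g - h))) + RCLike.re (y k (Aᶜ.indicator h)) := by
      conv_lhs => rw [hsplit]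
      simp only [map_add]
    rw [map_add, map_add]
    have r1 := RCLike.re_le_norm (y k (A.indicator g))
    have r2 := RCLike.re_le_norm (y k ((B \ A).indicator (g - h)))
    have r3 := RCLike.re_le_norm (y k ((A ∪ B)ᶜ.indicator (g - h)))
    linarith

/-- A bounded sequence of functionals on bounded measurable functions whose finite sections are
simultaneously large on the unit ball is frequently large at a single point of the unit ball. -/
theorem exists_frequently_large {M : ℝ} (hM : 0 ≤ M) {y : ℕ → (α → 𝕜) →ₗ[𝕜] 𝕜}
    (hy : ∀ n, IsBoundedFunctional M (y n)) {c : ℝ}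
    (hc : ∀ n, ∃ x ∈ measurableUnitBall α 𝕜, ∀ i ≤ n, c ≤ RCLike.re (y i x))
    {ε : ℝ} (hε : 0 < ε) :
    ∃ x ∈ measurableUnitBall α 𝕜, ∃ᶠ n in atTop, c - ε ≤ RCLike.re (y n x) := by
  obtain ⟨L, hL, hlim⟩ := exists_ultrafilter_limit (fun n => isMassFunctional_modulus (hy n))
    (hyperfilter ℕ)
  obtain ⟨h, hh, hloc⟩ := exists_local_modification hM hy (hyperfilter ℕ) hL hc (half_pos hε)
  obtain ⟨x, hx, hx1, hfreq⟩ := exists_glue hy Nat.hyperfilter_le_atTop hlim hh.1 hh.2 hloc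
    (half_pos hε)
  exact ⟨x, ⟨hx, hx1⟩, hfreq.mono fun n hn => by linarith⟩

end Localization

/-! ### Helly's theorem by finite-dimensional separation -/

section Helly

/-- A form of Helly's theorem: elements of the unit ball of the bidual are approximated by elements
of the unit ball on finitely many functionals. -/
theorem exists_norm_le_one_approx {𝕜 X : Type*} [RCLike 𝕜] [NormedAddCommGroup X]
    [NormedSpace 𝕜 X] (F : StrongDual 𝕜 (StrongDual 𝕜 X)) (hF : ‖F‖ ≤ 1) {ι : Type*} [Fintype ι]
    (ξ : ι → StrongDual 𝕜 X) {ε : ℝ} (hε : 0 < ε) :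
    ∃ x : X, ‖x‖ ≤ 1 ∧ ∀ i, ‖ξ i x - F (ξ i)‖ < ε := by
  classical
  let _ : NormedSpace ℝ X := NormedSpace.restrictScalars ℝ 𝕜 X
  let _ : IsScalarTower ℝ 𝕜 X := RestrictScalars.isScalarTower ℝ 𝕜 X
  let T : X →L[𝕜] (ι → 𝕜) := ContinuousLinearMap.pi ξ
  have hconv : Convex ℝ (T '' Metric.closedBall 0 1) :=
    (convex_closedBall (0 : X) 1).linear_image (T.restrictScalars ℝ).toLinearMap
  have hmem : (fun i => F (ξ i)) ∈ closure (T '' Metric.closedBall 0 1) := by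
    by_contra hnot
    -- A separating g pulls back along T to a functional on X of norm at most u, while F takes on it
    -- a value of real part above u, against ‖F‖ ≤ 1.
    obtain ⟨g, u, hgu, hu⟩ := RCLike.geometric_hahn_banach_closed_point (𝕜 := 𝕜)
      hconv.closure isClosed_closure hnot
    have hsum : ∀ v : ι → 𝕜, g v = ∑ i, g (Pi.single i 1) * v i := fun v => by
      conv_lhs => rw [pi_eq_sum_univ' v]
      simp [map_sum, mul_comm]
    have hζ : g.comp T = ∑ i, g (Pi.single i 1) • ξ i := by
      ext x
      simpa [T] using hsum (T x)
    have hFζ : F (g.comp T) = g fun i => F (ξ i) := by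
      rw [hζ, hsum]
      simp
    have hnorm : ‖g.comp T‖ ≤ u := by
      by_contra! hlt
      obtain ⟨x, hx, hux⟩ := (g.comp T).exists_lt_apply_of_lt_opNorm hlt
      obtain ⟨w, hw, hwx⟩ := exists_unimodular_mul_eq_norm (g.comp T x)
      have := hgu (T (w • x)) (subset_closure ⟨w • x, by simp [norm_smul, hw, hx.le], rfl⟩)
      rw [map_smul, map_smul, smul_eq_mul] at this
      have h2 : RCLike.re (w * g (T x)) = ‖g.comp T x‖ := by
        change w * g (T x) = _ at hwx
        rw [hwx, RCLike.ofReal_re]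
      linarith
    have h1 := RCLike.re_le_norm (F (g.comp T))
    have h2 := F.le_of_opNorm_le hF (g.comp T)
    rw [hFζ] at h1 h2
    linarith
  obtain ⟨_, ⟨x, hx, rfl⟩, hd⟩ := Metric.mem_closure_iff.1 hmem ε hε
  refine ⟨x, by simpa using hx, fun i => ?_⟩
  rw [← dist_eq_norm, dist_comm]
  exact (dist_le_pi_dist _ _ i).trans_lt hd

end Helly

/-! ### Passage from bounded measurable functions to L^∞ -/

section Linfty

open MeasureTheory

variable {α : Type*} [MeasurableSpace α] (𝕜 : Type*) [RCLike 𝕜]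

variable (α) in
/-- The space of bounded measurable functions. -/
def boundedMeasurable : Submodule 𝕜 (α → 𝕜) where
  carrier := {f | Measurable f ∧ ∃ C : ℝ, ∀ a, ‖f a‖ ≤ C}
  zero_mem' := ⟨measurable_zero, 0, fun a => by simp⟩
  add_mem' := by
    rintro f g ⟨hf, C, hC⟩ ⟨hg, D, hD⟩
    exact ⟨hf.add hg, C + D, fun a => (norm_add_le _ _).trans (add_le_add (hC a) (hD a))⟩
  smul_mem' := by
    rintro c f ⟨hf, C, hC⟩
    exact ⟨hf.const_smul c, ‖c‖ * C, fun a => by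
      rw [Pi.smul_apply, norm_smul]
      exact mul_le_mul_of_nonneg_left (hC a) (norm_nonneg _)⟩

variable (μ : Measure α)

theorem memLp_top_of_mem_boundedMeasurable {f : α → 𝕜} (hf : f ∈ boundedMeasurable α 𝕜) :
    MemLp f ∞ μ := by
  obtain ⟨hf, C, hC⟩ := hf
  exact memLp_top_of_bound hf.aestronglyMeasurable C (Eventually.of_forall hC)

/-- The quotient map from bounded measurable functions to `L^∞`. -/
noncomputable def toLinfty : boundedMeasurable α 𝕜 →ₗ[𝕜] Lp 𝕜 ∞ μ where
  toFun f := (memLp_top_of_mem_boundedMeasurable 𝕜 μ f.2).toLp f.1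
  map_add' f g := MemLp.toLp_add (memLp_top_of_mem_boundedMeasurable 𝕜 μ f.2)
    (memLp_top_of_mem_boundedMeasurable 𝕜 μ g.2)
  map_smul' c f := MemLp.toLp_const_smul c (memLp_top_of_mem_boundedMeasurable 𝕜 μ f.2)

theorem norm_toLinfty_le (f : boundedMeasurable α 𝕜) {C : ℝ} (hC : 0 ≤ C)
    (h : ∀ a, ‖f.1 a‖ ≤ C) : ‖toLinfty 𝕜 μ f‖ ≤ C := by
  refine (Lp.norm_toLp f.1 (memLp_top_of_mem_boundedMeasurable 𝕜 μ f.2)).trans_le (ENNReal.toReal_le_of_le_ofReal hC ?_)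
  rw [eLpNorm_exponent_top]
  exact eLpNormEssSup_le_of_ae_bound (Eventually.of_forall h)

/-- Setting a representative to 0 on the null set where it exceeds 1 makes the bound hold
everywhere. -/
theorem exists_toLinfty_eq (x : Lp 𝕜 ∞ μ) (hx : ‖x‖ ≤ 1) :
    ∃ f : boundedMeasurable α 𝕜, (∀ a, ‖f.1 a‖ ≤ 1) ∧ toLinfty 𝕜 μ f = x := by
  have hxm := (Lp.stronglyMeasurable x).measurable
  have hae : ∀ᵐ a ∂μ, ‖x a‖ ≤ 1 := by
    filter_upwards [ae_le_eLpNormEssSup (f := x) (μ := μ)] with a ha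
    rw [← eLpNorm_exponent_top, ← Lp.enorm_def] at ha
    exact (enorm_le_iff_norm_le.1 ha).trans hx
  have hS : MeasurableSet {a | ‖x a‖ ≤ 1} := measurableSet_le hxm.norm measurable_const
  have hb : ∀ a, ‖{a | ‖x a‖ ≤ 1}.indicator x a‖ ≤ 1 := fun a => by
    by_cases h : ‖x a‖ ≤ 1
    · rw [indicator_of_mem (show a ∈ {a | ‖x a‖ ≤ 1} from h)]
      exact h
    · rw [indicator_of_notMem (show a ∉ {a | ‖x a‖ ≤ 1} from h)]
      simp
  refine ⟨⟨_, hxm.indicator hS, 1, hb⟩, hb, ?_⟩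
  refine Lp.ext ((MemLp.coeFn_toLp
    (memLp_top_of_mem_boundedMeasurable 𝕜 μ ⟨hxm.indicator hS, 1, hb⟩)).trans ?_)
  filter_upwards [hae] with a ha
  exact indicator_of_mem (show a ∈ {a | ‖x a‖ ≤ 1} from ha) _

/-- Bounded sequences of functionals on `L^∞` that stay away from zero at a point of the unit ball
of the bidual stay frequently away from zero at a point of the unit ball. -/
theorem exists_frequently_large_Linfty {M : ℝ} (hM : 0 ≤ M) {ξ : ℕ → StrongDual 𝕜 (Lp 𝕜 ∞ μ)}
    (hξ : ∀ n, ‖ξ n‖ ≤ M) {F : StrongDual 𝕜 (StrongDual 𝕜 (Lp 𝕜 ∞ μ))} (hF : ‖F‖ ≤ 1) {c : ℝ}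
    (hc : ∀ n, c ≤ RCLike.re (F (ξ n))) {ε : ℝ} (hε : 0 < ε) :
    ∃ x : Lp 𝕜 ∞ μ, ‖x‖ ≤ 1 ∧ ∃ᶠ n in atTop, c - ε ≤ RCLike.re (ξ n x) := by
  -- The extension to all functions is purely algebraic; its values off the bounded measurable
  -- functions never matter.
  have hext : ∀ n, ∃ y : (α → 𝕜) →ₗ[𝕜] 𝕜,
      y ∘ₗ (boundedMeasurable α 𝕜).subtype = (ξ n).toLinearMap ∘ₗ toLinfty 𝕜 μ :=
    fun n => LinearMap.exists_extend _
  choose y hy using hext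
  have hyv : ∀ n (f : boundedMeasurable α 𝕜), y n f.1 = ξ n (toLinfty 𝕜 μ f) :=
    fun n f => LinearMap.congr_fun (hy n) f
  have hyb : ∀ n, IsBoundedFunctional M (y n) := fun n f hf C hC0 hC => by
    rw [hyv n ⟨f, hf, C, hC⟩]
    exact ((ξ n).le_of_opNorm_le (hξ n) _).trans
      (mul_le_mul_of_nonneg_left (norm_toLinfty_le 𝕜 μ _ hC0 hC) hM)
  obtain ⟨x, hx, hfreq⟩ := exists_frequently_large hM hyb (c := c - ε / 2) (fun n => by
    obtain ⟨x, hx, hxF⟩ := exists_norm_le_one_approx F hF (fun i : Fin (n + 1) => ξ i)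
      (half_pos hε)
    obtain ⟨f, hf, rfl⟩ := exists_toLinfty_eq 𝕜 μ x hx
    refine ⟨f.1, ⟨f.2.1, hf⟩, fun i hi => ?_⟩
    rw [hyv]
    have h1 := (RCLike.re_le_norm _).trans_lt
      ((norm_sub_rev _ _).trans_lt (hxF ⟨i, Nat.lt_succ_of_le hi⟩))
    rw [map_sub] at h1
    have h2 := hc i
    linarith) (half_pos hε)
  refine ⟨toLinfty 𝕜 μ ⟨x, hx.1, 1, hx.2⟩, norm_toLinfty_le 𝕜 μ _ zero_le_one hx.2,
    hfreq.mono fun n hn => ?_⟩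
  rw [← hyv]
  linarith

end Linfty

/-! ### Oscillation and the conclusion -/

theorem exists_lt_of_lt_seqOsc {𝕜 : Type*} [RCLike 𝕜] {a : ℕ → 𝕜} {r : ℝ≥0∞}
    (h : r < seqOsc a) (n : ℕ) : ∃ k ≥ n, ∃ l ≥ n, r < ‖a k - a l‖ₑ := by
  have := h.trans_le (iInf_le _ n)
  simpa only [lt_iSup_iff, exists_prop] using this

theorem le_seqOsc_of_frequently {𝕜 : Type*} [RCLike 𝕜] {a : ℕ → 𝕜} {r : ℝ≥0∞}
    (h : ∀ n, ∃ k ≥ n, ∃ l ≥ n, r ≤ ‖a k - a l‖ₑ) : r ≤ seqOsc a := by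
  refine le_iInf fun n => ?_
  obtain ⟨k, hk, l, hl, hr⟩ := h n
  exact hr.trans (le_iSup₂_of_le k hk (le_iSup₂_of_le l hl le_rfl))

theorem corollary4p3 (𝕜 : Type*) [RCLike 𝕜] {α : Type*} [MeasurableSpace α]
    (μ : MeasureTheory.Measure α) [MeasureTheory.SigmaFinite μ] :
    IsGrothendieckWith 𝕜 1 (MeasureTheory.Lp 𝕜 ∞ μ) := by
  intro ξ hξ
  obtain ⟨M, hM0, hM⟩ := hξ.exists_pos_norm_le
  replace hM : ∀ n, ‖ξ n‖ ≤ M := fun n => hM _ (mem_range_self n)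
  rw [ENNReal.coe_one, one_mul]
  refine iSup₂_le fun F hF => le_of_forall_lt fun r hr => ?_
  obtain ⟨s, hrs, hs⟩ := ENNReal.lt_iff_exists_nnreal_btwn.1 hr
  refine hrs.trans_le ?_
  choose k hk l hl hkl using exists_lt_of_lt_seqOsc hs
  -- The rotated differences have real F-values above s. As k n, l n ≥ n, a point where infinitely
  -- many of them are large has large oscillation.
  choose u hu huF using fun n =>
    exists_unimodular_mul_eq_norm (F (ξ (k n)) - F (ξ (l n)))
  refine ENNReal.le_of_forall_pos_le_add fun ε hε _ => ?_
  obtain ⟨x, hx, hfreq⟩ := exists_frequently_large_Linfty 𝕜 μ (M := 2 * M) (by positivity)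
    (ξ := fun n => u n • (ξ (k n) - ξ (l n)))
    (fun n => by
      rw [norm_smul, hu, one_mul]
      exact (norm_sub_le _ _).trans (by linarith [hM (k n), hM (l n)])) hF (c := s)
    (fun n => by
      rw [map_smul, map_sub, smul_eq_mul, huF, RCLike.ofReal_re]
      have := hkl n
      rw [enorm_eq_nnnorm, ENNReal.coe_lt_coe, ← NNReal.coe_lt_coe, coe_nnnorm] at this
      exact this.le) (ε := ε) hε
  have hosc : (s : ℝ≥0∞) - ε ≤ seqOsc fun n => ξ n x := by
    refine le_seqOsc_of_frequently fun n => ?_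
    obtain ⟨m, hm, hmx⟩ := frequently_atTop.1 hfreq n
    refine ⟨k m, hm.trans (hk m), l m, hm.trans (hl m), ?_⟩
    have h1 := hmx.trans (RCLike.re_le_norm _)
    rw [smul_apply, norm_smul, hu, one_mul, sub_apply] at h1
    rw [tsub_le_iff_right, enorm_eq_nnnorm, ← ENNReal.coe_add, ENNReal.coe_le_coe,
      ← NNReal.coe_le_coe, NNReal.coe_add, coe_nnnorm]
    linarith
  exact tsub_le_iff_right.1 (hosc.trans (le_iSup₂_of_le x hx le_rfl))
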